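/- **Notation and definitions.** All spaces $\mathbb{R}^n$ carry the Euclidean inner product and norm, and $\mathbb{R}^n\times\mathbb{R}^m$ carries the norm $\|(u,v)\|=\sqrt{\|u\|^2+\|v\|^2}$. For a family of sets $S(t)$, $\operatorname{Limsup}_{t\to l}S(t)$ denotes the set of all limits of convergent sequences $w_k\in S(t_k)$ with $t_k\to l$. For $A\subset\mathbb{R}^n$ and $x\in A$ let $$T_A(x)=\operatorname*{Limsup}_{t\searrow 0}\frac{A-x}{t},\qquad \widehat N_A(x)=\{x^*\mid \langle x^*,v\rangle\le 0\ \ \forall v\in T_A(x)\}$$ be the tangent (Bouligand) cone and the regular (Fréchet) normal cone, with $\widehat N_A(x)=\emptyset$ for $x\notin A$. For $\bar x\in A$ and $d\in\mathbb{R}^n$ let $$N_A(\bar x;d)=\operatorname*{Limsup}_{t\searrow 0,\ d'\to d}\widehat N_A(\bar x+td')$$ be the limiting normal cone in direction $d$. The set $A$ is called semismooth* at $\bar x\in A$ if $\langle x^*,u\rangle=0$ for all $u\in\mathbb{R}^n$ and all $x^*\in N_A(\bar x;u)$. A mapping $f:\mathbb{R}^n\to\mathbb{R}^m$ is called semismooth*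 at $\bar x$ if its graph $\{(x,f(x))\mid x\in\mathbb{R}^n\}\subset\mathbb{R}^n\times\mathbb{R}^m$ is semismooth* at $(\bar x,f(\bar x))$. **Proposition.** Let $A\subset\mathbb{R}^s$ be closed and let $\bar x\in A$. Then $A$ is semismooth* at $\bar x$ if and only if the distance function $d_A:\mathbb{R}^s\to\mathbb{R}$, $d_A(x)=\inf_{z\in A}\|x-z\|$, is semismooth* at $\bar x$. -/

import Mathlib

open Filter Set
open scoped Topology RealInnerProductSpace

namespace SemismoothStar

/-- The Painlevé–Kuratowski outer (upper) limit `Limsup_{t → l} S t` of a family of sets: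
all limits of sequences `w n ∈ S (t n)` with `t n → l`. -/
def outerLimit {α E : Type*} [TopologicalSpace E] (l : Filter α) (S : α → Set E) : Set E :=
  {v | ∃ (t : ℕ → α) (w : ℕ → E),
    Tendsto t atTop l ∧ (∀ n, w n ∈ S (t n)) ∧ Tendsto w atTop (𝓝 v)}

section Cones

variable {E : Type*} [NormedAddCommGroup E] [InnerProductSpace ℝ E]

/-- The tangent (contingent, Bouligand) cone `T_A(x) = Limsup_{t ↘ 0} (A - x) / t`;
for `t > 0` one has `v ∈ (A - x) / t` if and only if `x + t v ∈ A`. -/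
def tangentCone (A : Set E) (x : E) : Set E :=
  outerLimit (𝓝[>] (0 : ℝ)) (fun t => {v | x + t • v ∈ A})

/-- The (negative) polar cone of a set. -/
def negPolar (K : Set E) : Set E :=
  {p | ∀ v ∈ K, ⟪p, v⟫ ≤ 0}

/-- The regular (Fréchet) normal cone: the polar of the tangent cone at points of `A`,
and the empty set at points outside `A`. -/
def regularNormalCone (A : Set E) (x : E) : Set E :=
  {p | x ∈ A ∧ p ∈ negPolar (tangentCone A x)}

/-- The directional limiting normal cone
`N_A(x; d) = Limsup_{t ↘ 0, d' → d} (regular normal cone of A at x + t d')`. -/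
def directionalNormalCone (A : Set E) (x d : E) : Set E :=
  outerLimit (𝓝[>] (0 : ℝ) ×ˢ 𝓝 d)
    (fun q : ℝ × E => regularNormalCone A (x + q.1 • q.2))

/-- A set `A` is semismooth* at the point `x` (of `A`). -/
def IsSemismoothStarSet (A : Set E) (x : E) : Prop :=
  ∀ u : E, ∀ p ∈ directionalNormalCone A x u, ⟪p, u⟫ = 0

end Cones

section Mappings

variable {E F : Type*} [NormedAddCommGroup E] [InnerProductSpace ℝ E]
  [NormedAddCommGroup F] [InnerProductSpace ℝ F]

/-- The graph of a set-valued mapping, in the product space with the Euclidean norm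
`‖(u, v)‖ = √(‖u‖² + ‖v‖²)`. -/
def gph (Φ : E → Set F) : Set (WithLp 2 (E × F)) :=
  {z | z.snd ∈ Φ z.fst}

/-- A set-valued mapping is semismooth* at the point `(x, y)` of its graph if its graph is a
semismooth* set at `(x, y)`. -/
def IsSemismoothStarMap (Φ : E → Set F) (x : E) (y : F) : Prop :=
  IsSemismoothStarSet (gph Φ) (WithLp.toLp 2 (x, y))

/-- A single-valued mapping is semismooth* at `x` if the set-valued mapping `z ↦ {f z}` is
semismooth* at `(x, f x)`. -/
def IsSemismoothStarFun (f : E → F) (x : E) : Prop :=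
  IsSemismoothStarMap (fun z => {f z}) x (f x)

end Mappings

end SemismoothStar

namespace SemismoothStar

section ProductNorm

variable {E : Type*} [NormedAddCommGroup E]

/-! By compactness, semismoothness* at `x` is the uniform estimate `|⟪p, y - x⟫| ≤ ε ‖y - x‖ ‖p‖`
for regular normals `p` at points `y` near `x` (`isSemismoothStarSet_iff_eventually`). This estimate
is transferred between `A` and the graph of the distance.

From graph to set: a regular normal `p` to `A` lifts to the normal `(p, -‖p‖)` of the graph, over a
point where the distance vanishes.

From set to graph: over points of `A`, normals project to normals of `A`. At `x ∉ A`, the graph has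
a tangent `(v, ⟪x - z, v⟫ / ‖x - z‖)` with `z` a nearest point; since `x - z` is a regular normal at
`z`, the estimate at `z` shows that for `v = ±(x - y)` this slope is nearly `± d_A(x)`. Testing a
graph normal against both tangents bounds its product with `(x - y, d_A(x))`. -/

theorem norm_le_norm_toLp (x : E) (r : ℝ) : ‖x‖ ≤ ‖WithLp.toLp 2 (x, r)‖ := by
  refine le_of_sq_le_sq ?_ (norm_nonneg _)
  rw [WithLp.prod_norm_sq_eq_of_L2]
  simp [sq_nonneg]

theorem abs_le_norm_toLp (x : E) (r : ℝ) : |r| ≤ ‖WithLp.toLp 2 (x, r)‖ := by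
  refine le_of_sq_le_sq ?_ (norm_nonneg _)
  rw [WithLp.prod_norm_sq_eq_of_L2]
  simp

theorem norm_toLp_le (x : E) (r : ℝ) : ‖WithLp.toLp 2 (x, r)‖ ≤ ‖x‖ + |r| := by
  refine le_of_sq_le_sq ?_ (by positivity)
  rw [WithLp.prod_norm_sq_eq_of_L2]
  simp only [Real.norm_eq_abs, WithLp.toLp_fst, WithLp.toLp_snd]
  nlinarith [norm_nonneg x, abs_nonneg r, mul_nonneg (norm_nonneg x) (abs_nonneg r)]

end ProductNorm

/-! ### Regular normals and the uniform estimate. -/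

section Cones

variable {E : Type*} [NormedAddCommGroup E] [InnerProductSpace ℝ E]

theorem smul_mem_regularNormalCone {A : Set E} {x p : E} (hp : p ∈ regularNormalCone A x)
    {c : ℝ} (hc : 0 ≤ c) : c • p ∈ regularNormalCone A x := by
  refine ⟨hp.1, fun v hv => ?_⟩
  rw [real_inner_smul_left]
  exact mul_nonpos_of_nonneg_of_nonpos hc (hp.2 v hv)

/-- In a finite-dimensional space the semismooth* property is an estimate on the regular
normals at nearby points. -/
theorem isSemismoothStarSet_iff_eventually [FiniteDimensional ℝ E] {A : Set E} {x : E} :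
    IsSemismoothStarSet A x ↔ ∀ ε > 0, ∀ᶠ y in 𝓝 x, ∀ p ∈ regularNormalCone A y,
      |⟪p, y - x⟫| ≤ ε * (‖y - x‖ * ‖p‖) := by
  constructor
  · intro h ε hε
    by_contra hcon
    have hfreq : ∃ᶠ y in 𝓝 x, ∃ p ∈ regularNormalCone A y,
        ε * (‖y - x‖ * ‖p‖) < |⟪p, y - x⟫| := by
      refine (Filter.not_eventually.1 hcon).mono fun y hy => ?_
      push Not at hy
      exact hy
    obtain ⟨y, hy, hyp⟩ := Filter.exists_seq_forall_of_frequently hfreq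
    choose p hpN hp using hyp
    have hy0 : ∀ n, y n - x ≠ 0 := fun n h0 => by
      have := hp n
      simp [h0] at this
    have hp0 : ∀ n, p n ≠ 0 := fun n h0 => by
      have := hp n
      simp [h0] at this
    have hbdd : ∀ n, (NormedSpace.normalize (y n - x), NormedSpace.normalize (p n)) ∈
        Metric.closedBall (0 : E × E) 1 := fun n => by
      simp [Prod.norm_def, NormedSpace.norm_normalize_eq_one_iff.2 (hy0 n),
        NormedSpace.norm_normalize_eq_one_iff.2 (hp0 n)]
    -- A cluster point of the normalized violating pairs is a direction with a directional normal
    -- not orthogonal to it.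
    obtain ⟨⟨u, q⟩, -, φ, hφ, hlim⟩ :=
      (isCompact_closedBall (0 : E × E) 1).tendsto_subseq hbdd
    have hu : Tendsto (fun n => NormedSpace.normalize (y (φ n) - x)) atTop (𝓝 u) :=
      (continuous_fst.tendsto _).comp hlim
    have hq : Tendsto (fun n => NormedSpace.normalize (p (φ n))) atTop (𝓝 q) :=
      (continuous_snd.tendsto _).comp hlim
    have hmem : q ∈ directionalNormalCone A x u := by
      refine ⟨fun n => (‖y (φ n) - x‖, NormedSpace.normalize (y (φ n) - x)),
        fun n => NormedSpace.normalize (p (φ n)), ?_, fun n => ?_, hq⟩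
      · refine Tendsto.prodMk (tendsto_nhdsWithin_iff.2 ⟨?_, .of_forall fun n => ?_⟩) hu
        · have := ((hy.comp hφ.tendsto_atTop).sub_const x).norm
          simpa using this
        · exact norm_pos_iff.2 (hy0 _)
      · have : x + ‖y (φ n) - x‖ • NormedSpace.normalize (y (φ n) - x) = y (φ n) := by
          rw [NormedSpace.norm_smul_normalize]; abel
        simp only [this]
        exact smul_mem_regularNormalCone (hpN _) (by positivity)
    have hle : ε ≤ |⟪q, u⟫| := by
      refine ge_of_tendsto' (hq.inner hu).abs fun n => ?_
      have h1 := hp (φ n)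
      have h2 : 0 < ‖y (φ n) - x‖ := norm_pos_iff.2 (hy0 _)
      have h3 : 0 < ‖p (φ n)‖ := norm_pos_iff.2 (hp0 _)
      simp only [NormedSpace.normalize, real_inner_smul_left, real_inner_smul_right, abs_mul,
        abs_inv, abs_norm]
      rw [← mul_assoc, ← mul_inv, mul_comm, ← div_eq_mul_inv, le_div_iff₀ (by positivity)]
      exact h1.le
    rw [h u q hmem, abs_zero] at hle
    exact hε.not_ge hle
  · rintro h u q ⟨t, w, ht, hw, hwq⟩
    have ht1 : Tendsto (fun n => (t n).1) atTop (𝓝[>] 0) := tendsto_fst.comp ht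
    have ht2 : Tendsto (fun n => (t n).2) atTop (𝓝 u) := tendsto_snd.comp ht
    have hy : Tendsto (fun n => x + (t n).1 • (t n).2) atTop (𝓝 x) := by
      simpa using ((tendsto_nhds_of_tendsto_nhdsWithin ht1).smul ht2).const_add x
    have key : ∀ ε > 0, |⟪q, u⟫| ≤ ε * (‖u‖ * ‖q‖) := by
      intro ε hε
      refine le_of_tendsto_of_tendsto (hwq.inner ht2).abs
        ((ht2.norm.mul hwq.norm).const_mul ε) ?_
      filter_upwards [hy.eventually (h ε hε), (tendsto_nhdsWithin_iff.1 ht1).2] with n hn hpos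
      have := hn _ (hw n)
      have hpos : 0 < (t n).1 := hpos
      rw [add_sub_cancel_left, real_inner_smul_right, abs_mul, norm_smul, Real.norm_eq_abs,
        abs_of_pos hpos] at this
      refine le_of_mul_le_mul_left ?_ hpos
      linarith
    have hlim : Tendsto (fun ε : ℝ => ε * (‖u‖ * ‖q‖)) (𝓝[>] 0) (𝓝 0) := by
      have : Tendsto (fun ε : ℝ => ε * (‖u‖ * ‖q‖)) (𝓝 0) (𝓝 (0 * (‖u‖ * ‖q‖))) :=
        tendsto_id.mul_const _
      rw [zero_mul] at this
      exact this.mono_left nhdsWithin_le_nhds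
    exact abs_nonpos_iff.1 (ge_of_tendsto hlim (eventually_nhdsWithin_of_forall key))

/-- The vector from a nearest point of a set is a regular normal at this nearest point. -/
theorem sub_mem_regularNormalCone_of_infDist_eq {A : Set E} {x z : E} (hz : z ∈ A)
    (hxz : Metric.infDist x A = ‖x - z‖) : x - z ∈ regularNormalCone A z := by
  refine ⟨hz, ?_⟩
  rintro v ⟨t, w, ht, hw, hwv⟩
  have ht0 : Tendsto t atTop (𝓝 0) := tendsto_nhds_of_tendsto_nhdsWithin ht
  have hlim : Tendsto (fun n => t n * ‖w n‖ ^ 2) atTop (𝓝 (0 * ‖v‖ ^ 2)) :=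
    ht0.mul (hwv.norm.pow 2)
  have hlim2 : Tendsto (fun n => 2 * ⟪x - z, w n⟫) atTop (𝓝 (2 * ⟪x - z, v⟫)) :=
    (tendsto_const_nhds.inner hwv).const_mul 2
  -- Expanding `‖x - z‖² ≤ ‖x - z - t w‖²` gives `2⟪x - z, w⟫ ≤ t‖w‖²`.
  have := le_of_tendsto_of_tendsto hlim2 hlim (by
    filter_upwards [(tendsto_nhdsWithin_iff.1 ht).2] with n hpos
    have hpos : 0 < t n := hpos
    have h1 : ‖x - z‖ ≤ ‖x - z - t n • w n‖ := by
      have := Metric.infDist_le_dist_of_mem (s := A) (x := x) (hw n)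
      rwa [hxz, dist_eq_norm, ← sub_sub] at this
    have h2 : ‖x - z‖ ^ 2 ≤ ‖x - z - t n • w n‖ ^ 2 := by gcongr
    rw [norm_sub_sq_real (x - z), real_inner_smul_right, norm_smul, mul_pow, Real.norm_eq_abs,
      sq_abs] at h2
    refine le_of_mul_le_mul_left ?_ hpos
    nlinarith)
  linarith

/-- Subgradient inequality for the norm; at `a = 0` the quotient is `0` by convention. -/
theorem real_inner_div_norm_le_norm_sub_norm (a b : E) : ⟪a, b - a⟫ / ‖a‖ ≤ ‖b‖ - ‖a‖ := by
  rcases eq_or_ne a 0 with rfl | ha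
  · simp
  · have := norm_pos_iff.2 ha
    rw [div_le_iff₀ this, inner_sub_right, real_inner_self_eq_norm_sq]
    nlinarith [real_inner_le_norm a b]

end Cones

/-! ### Tangents and normals to the graph of the distance. -/

section Distance

variable {E : Type*} [NormedAddCommGroup E] [InnerProductSpace ℝ E]

/-- The graph of the distance function to a set. -/
abbrev infDistGraph (A : Set E) : Set (WithLp 2 (E × ℝ)) :=
  gph fun x => {Metric.infDist x A}

theorem toLp_add_smul_mem_infDistGraph {A : Set E} {x : E} {r t : ℝ}
    {w : WithLp 2 (E × ℝ)} : WithLp.toLp 2 (x, r) + t • w ∈ infDistGraph A ↔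
      r + t * w.snd = Metric.infDist (x + t • w.fst) A := Iff.rfl

theorem toLp_mem_tangentCone_infDistGraph {A : Set E} {x v : E} {η : ℝ} {t : ℕ → ℝ}
    {w : ℕ → E} (ht : Tendsto t atTop (𝓝[>] 0)) (ht0 : ∀ n, t n ≠ 0)
    (hw : Tendsto w atTop (𝓝 v))
    (hη : Tendsto (fun n => (Metric.infDist (x + t n • w n) A - Metric.infDist x A) / t n)
      atTop (𝓝 η)) :
    WithLp.toLp 2 (v, η) ∈
      tangentCone (infDistGraph A) (WithLp.toLp 2 (x, Metric.infDist x A)) := by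
  refine ⟨t, _, ht, fun n => ?_,
    ((WithLp.prod_continuous_toLp 2 E ℝ).tendsto _).comp (hw.prodMk_nhds hη)⟩
  refine toLp_add_smul_mem_infDistGraph.2 ?_
  change _ + t n * (_ / t n) = Metric.infDist (x + t n • w n) A
  rw [mul_div_cancel₀ _ (ht0 n), add_sub_cancel]

/-- At a point of the set, regular normals to the graph of the distance function project to
regular normals to the set. -/
theorem fst_mem_regularNormalCone {A : Set E} {x : E} (hx : x ∈ A) {q : WithLp 2 (E × ℝ)}
    (hq : q ∈ regularNormalCone (infDistGraph A) (WithLp.toLp 2 (x, Metric.infDist x A))) :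
    q.fst ∈ regularNormalCone A x := by
  refine ⟨hx, ?_⟩
  rintro v ⟨t, w, ht, hw, hwv⟩
  -- The distance stays zero along points of `A`, so tangents to `A` lift with slope zero.
  have hmem : WithLp.toLp 2 (v, (0 : ℝ)) ∈
      tangentCone (infDistGraph A) (WithLp.toLp 2 (x, Metric.infDist x A)) := by
    refine ⟨t, _, ht, fun n => ?_,
      ((WithLp.prod_continuous_toLp 2 E ℝ).tendsto _).comp
        (hwv.prodMk_nhds (tendsto_const_nhds (x := (0 : ℝ))))⟩
    refine toLp_add_smul_mem_infDistGraph.2 ?_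
    change _ + t n * 0 = Metric.infDist (x + t n • w n) A
    rw [Metric.infDist_zero_of_mem hx, Metric.infDist_zero_of_mem (s := A) (hw n), mul_zero,
      add_zero]
  simpa [WithLp.prod_inner_apply] using hq.2 _ hmem

variable [FiniteDimensional ℝ E]

/-- For a tangent `(v, η)` to the graph, rescaled nearest points converge to some `u` tangent to `A`
with `η = ‖v - u‖`. Hence `⟪p, v⟫ - ‖p‖ η ≤ ⟪p, u⟫ ≤ 0` by Cauchy–Schwarz. -/
theorem toLp_neg_norm_mem_regularNormalCone {A : Set E} (hA : IsClosed A) {x p : E}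
    (hp : p ∈ regularNormalCone A x) :
    WithLp.toLp 2 (p, -‖p‖) ∈
      regularNormalCone (infDistGraph A) (WithLp.toLp 2 (x, Metric.infDist x A)) := by
  refine ⟨rfl, ?_⟩
  rintro v ⟨t, w, ht, hw, hwv⟩
  have hx := hp.1
  have hpos : ∀ᶠ n in atTop, 0 < t n := (tendsto_nhdsWithin_iff.1 ht).2
  have hw1 : Tendsto (fun n => (w n).fst) atTop (𝓝 v.fst) :=
    ((WithLp.prod_continuous_ofLp 2 E ℝ).fst.tendsto v).comp hwv
  have hw2 : Tendsto (fun n => (w n).snd) atTop (𝓝 v.snd) :=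
    ((WithLp.prod_continuous_ofLp 2 E ℝ).snd.tendsto v).comp hwv
  have hproj := fun n => hA.exists_infDist_eq_dist ⟨x, hx⟩ (x + t n • (w n).fst)
  choose z hzA hz using hproj
  have hgap : ∀ n, 0 < t n → ‖(w n).fst - (t n)⁻¹ • (z n - x)‖ = (w n).snd := by
    intro n hn
    have h1 := toLp_add_smul_mem_infDistGraph.1 (hw n)
    rw [Metric.infDist_zero_of_mem hx, zero_add, hz n, dist_eq_norm] at h1
    have h2 : (w n).fst - (t n)⁻¹ • (z n - x) =
        (t n)⁻¹ • (x + t n • (w n).fst - z n) := by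
      rw [add_sub_right_comm, smul_add, inv_smul_smul₀ hn.ne', ← neg_sub (z n) x, smul_neg]
      abel
    rw [h2, norm_smul, norm_inv, Real.norm_eq_abs, abs_of_pos hn, ← h1]
    field_simp
  have hev : ∀ᶠ n in atTop, (t n)⁻¹ • (z n - x) ∈
      Metric.closedBall (0 : E) (‖v.fst‖ + 1 + (v.snd + 1)) := by
    filter_upwards [hpos, hw1.norm.eventually_le_const (lt_add_one _),
      hw2.eventually_le_const (lt_add_one _)] with n h1 h2 h3
    rw [mem_closedBall_zero_iff]
    have h4 := hgap n h1
    have h5 := norm_sub_norm_le ((t n)⁻¹ • (z n - x)) (w n).fst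
    rw [norm_sub_rev] at h5
    linarith
  obtain ⟨u, -, φ, hφ, hu⟩ := (isCompact_closedBall (0 : E) _).tendsto_subseq' hev.frequently
  have hpos' := hφ.tendsto_atTop.eventually hpos
  have hdist : ‖v.fst - u‖ = v.snd := by
    refine tendsto_nhds_unique_of_eventuallyEq
      ((hw1.comp hφ.tendsto_atTop).sub hu).norm (hw2.comp hφ.tendsto_atTop) ?_
    filter_upwards [hpos'] with n hn
    exact hgap _ hn
  have hutan : u ∈ tangentCone A x := by
    -- `outerLimit` asks for membership at every index, while `t` is only eventually positive, so
    -- the sequence is shifted.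
    obtain ⟨N, hN⟩ := eventually_atTop.1 hpos'
    refine ⟨fun n => t (φ (n + N)), fun n => (t (φ (n + N)))⁻¹ • (z (φ (n + N)) - x),
      ht.comp (hφ.tendsto_atTop.comp (tendsto_add_atTop_nat N)), fun n => ?_,
      hu.comp (tendsto_add_atTop_nat N)⟩
    have := hN (n + N) (Nat.le_add_left _ _)
    change x + t _ • _ ∈ A
    rw [smul_inv_smul₀ this.ne', add_sub_cancel]
    exact hzA _
  have h1 := hp.2 u hutan
  have h2 := real_inner_le_norm p (v.fst - u)
  rw [hdist, inner_sub_right] at h2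
  rw [WithLp.prod_inner_apply]
  simp
  nlinarith

/-- Every direction `v` extends to a tangent to the graph of the distance function whose slope
is the slope of the distance to some nearest point. -/
theorem exists_tangent_infDistGraph {A : Set E} (hA : IsClosed A) {x : E} (hne : A.Nonempty)
    (hx : x ∉ A) (v : E) :
    ∃ z ∈ A, Metric.infDist x A = ‖x - z‖ ∧ WithLp.toLp 2 (v, ⟪x - z, v⟫ / ‖x - z‖) ∈
      tangentCone (infDistGraph A) (WithLp.toLp 2 (x, Metric.infDist x A)) := by
  obtain ⟨t, -, htpos, ht⟩ := exists_seq_strictAnti_tendsto (0 : ℝ)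
  have htw : Tendsto t atTop (𝓝[>] 0) := tendsto_nhdsWithin_iff.2 ⟨ht, .of_forall htpos⟩
  choose z hzA hz using fun n => hA.exists_infDist_eq_dist hne (x + t n • v)
  have hxn : Tendsto (fun n => x + t n • v) atTop (𝓝 x) := by
    simpa using (ht.smul_const v).const_add x
  have hdn : Tendsto (fun n => Metric.infDist (x + t n • v) A) atTop
      (𝓝 (Metric.infDist x A)) := ((Metric.continuous_infDist_pt A).tendsto x).comp hxn
  have hev : ∀ᶠ n in atTop, z n ∈ Metric.closedBall x (Metric.infDist x A + 1 + 1) := by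
    filter_upwards [hdn.eventually_le_const (lt_add_one _),
      hxn (Metric.closedBall_mem_nhds x one_pos)] with n h1 h2
    rw [hz n] at h1
    have h2 : dist (x + t n • v) x ≤ 1 := h2
    rw [Metric.mem_closedBall]
    linarith [dist_triangle_left (z n) x (x + t n • v)]
  obtain ⟨y, -, φ, hφ, hy⟩ := (isCompact_closedBall x _).tendsto_subseq' hev.frequently
  have hyA : y ∈ A := hA.mem_of_tendsto hy (.of_forall fun n => hzA _)
  have hyd : Metric.infDist x A = ‖x - y‖ := by
    refine tendsto_nhds_unique (hdn.comp hφ.tendsto_atTop) ?_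
    have := ((hxn.comp hφ.tendsto_atTop).sub hy).norm
    refine this.congr fun n => ?_
    simp [hz, dist_eq_norm]
  have hxy : x - y ≠ 0 := fun h => hx (sub_eq_zero.1 h ▸ hyA)
  refine ⟨y, hyA, hyd, toLp_mem_tangentCone_infDistGraph (htw.comp hφ.tendsto_atTop)
    (fun n => (htpos _).ne') tendsto_const_nhds ?_⟩
  have hlow : Tendsto (fun n => ⟪x - z (φ n), v⟫ / ‖x - z (φ n)‖) atTop
      (𝓝 (⟪x - y, v⟫ / ‖x - y‖)) :=
    ((hy.const_sub x).inner tendsto_const_nhds).div (hy.const_sub x).norm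
      (norm_ne_zero_iff.2 hxy)
  have hup : Tendsto (fun n => ⟪x + t (φ n) • v - y, v⟫ / ‖x + t (φ n) • v - y‖) atTop
      (𝓝 (⟪x - y, v⟫ / ‖x - y‖)) := by
    have h := (hxn.comp hφ.tendsto_atTop).sub_const y
    exact (h.inner tendsto_const_nhds).div h.norm (norm_ne_zero_iff.2 hxy)
  -- Lower bound: the nearest point of `x + t v` competes at `x`. Upper bound: the limit `y`
  -- competes at `x + t v`.
  refine tendsto_of_tendsto_of_tendsto_of_le_of_le hlow hup (fun n => ?_) (fun n => ?_)
  · have h1 := real_inner_div_norm_le_norm_sub_norm (x - z (φ n)) (x + t (φ n) • v - z (φ n))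
    have h2 := Metric.infDist_le_dist_of_mem (x := x) (hzA (φ n))
    rw [sub_sub_sub_cancel_right, add_sub_cancel_left, real_inner_smul_right] at h1
    simp only [Function.comp]
    rw [le_div_iff₀ (htpos _), hz, dist_eq_norm]
    rw [dist_eq_norm] at h2
    have : ⟪x - z (φ n), v⟫ / ‖x - z (φ n)‖ * t (φ n) =
      t (φ n) * ⟪x - z (φ n), v⟫ / ‖x - z (φ n)‖ := by ring
    linarith
  · have h1 := real_inner_div_norm_le_norm_sub_norm (x + t (φ n) • v - y) (x - y)
    have h2 := Metric.infDist_le_dist_of_mem (x := x + t (φ n) • v) hyA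
    rw [sub_sub_sub_cancel_right, sub_add_cancel_left, inner_neg_right,
      real_inner_smul_right] at h1
    simp only [Function.comp]
    rw [div_le_iff₀ (htpos _), hyd]
    rw [dist_eq_norm] at h2
    have : ⟪x + t (φ n) • v - y, v⟫ / ‖x + t (φ n) • v - y‖ * t (φ n) =
      -(-(t (φ n) * ⟪x + t (φ n) • v - y, v⟫) / ‖x + t (φ n) • v - y‖) := by ring
    linarith

/-- Estimate on the regular normals to the graph of the distance function at points outside
the set. -/
theorem inner_add_mul_infDist_le {A : Set E} (hA : IsClosed A) {x y v : E} (hy : y ∈ A)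
    (hx : x ∉ A) {ε σ : ℝ} (hε : 0 ≤ ε) (hσ : |σ| = 1) (hv : v = σ • (x - y))
    (hest : ∀ z ∈ A, ‖z - y‖ ≤ 2 * ‖x - y‖ → ∀ p ∈ regularNormalCone A z,
      |⟪p, z - y⟫| ≤ ε * (‖z - y‖ * ‖p‖)) {q : WithLp 2 (E × ℝ)}
    (hq : q ∈ regularNormalCone (infDistGraph A) (WithLp.toLp 2 (x, Metric.infDist x A))) :
    σ * (⟪q.fst, x - y⟫ + q.snd * Metric.infDist x A) ≤ 2 * ε * (‖x - y‖ * |q.snd|) := by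
  obtain ⟨z, hzA, hz, htan⟩ := exists_tangent_infDistGraph hA ⟨y, hy⟩ hx v
  have h1 := hq.2 _ htan
  have hd : ‖x - z‖ ≤ ‖x - y‖ := by
    rw [← hz, ← dist_eq_norm]; exact Metric.infDist_le_dist_of_mem hy
  have hzy : ‖z - y‖ ≤ 2 * ‖x - y‖ := by
    have := norm_sub_le_norm_sub_add_norm_sub z x y
    rw [norm_sub_rev z x] at this
    linarith
  have h2 := hest z hzA hzy _ (sub_mem_regularNormalCone_of_infDist_eq hzA hz)
  have hpos : 0 < ‖x - z‖ := norm_pos_iff.2 fun h => hx (sub_eq_zero.1 h ▸ hzA)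
  have h3 : ⟪x - z, x - y⟫ = ⟪x - z, z - y⟫ + ‖x - z‖ ^ 2 := by
    rw [← real_inner_self_eq_norm_sq, ← inner_add_right]
    congr 1
    abel
  -- The slope along `v` is `σ (s + d_A(x))`; the error `s` is what the estimate at `z` controls.
  set s := ⟪x - z, z - y⟫ / ‖x - z‖ with hs
  have h4 : |s| ≤ ε * ‖z - y‖ := by
    rw [hs, abs_div, abs_norm, div_le_iff₀ hpos]
    linarith
  have h5 : ⟪x - z, v⟫ / ‖x - z‖ = σ * (s + ‖x - z‖) := by
    rw [hv, real_inner_smul_right, h3, hs]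
    field_simp
  rw [h5, hv, WithLp.prod_inner_apply] at h1
  simp only [real_inner_smul_right, RCLike.inner_apply, conj_trivial] at h1
  change σ * ⟪q.fst, x - y⟫ + σ * (s + ‖x - z‖) * q.snd ≤ 0 at h1
  have h6 : -(σ * q.snd * s) ≤ |q.snd| * (ε * (2 * ‖x - y‖)) := by
    calc -(σ * q.snd * s) ≤ |σ * q.snd * s| := neg_le_abs _
      _ = |q.snd| * |s| := by rw [abs_mul, abs_mul, hσ, one_mul]
      _ ≤ |q.snd| * (ε * (2 * ‖x - y‖)) := by
        gcongr
        exact h4.trans (by gcongr)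
  rw [hz]
  nlinarith

theorem isSemismoothStarSet_iff_isSemismoothStarFun_infDist {A : Set E} (hA : IsClosed A)
    {y : E} (hy : y ∈ A) :
    IsSemismoothStarSet A y ↔ IsSemismoothStarFun (fun x => Metric.infDist x A) y := by
  have hy0 : Metric.infDist y A = 0 := Metric.infDist_zero_of_mem hy
  change _ ↔ IsSemismoothStarSet (infDistGraph A) (WithLp.toLp 2 (y, Metric.infDist y A))
  rw [isSemismoothStarSet_iff_eventually, isSemismoothStarSet_iff_eventually]
  constructor
  · intro h ε hε
    -- Both halvings, of `ε` and of `δ`, absorb the factor in `‖z - y‖ ≤ 2‖x - y‖`.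
    obtain ⟨δ, hδ, hball⟩ := Metric.eventually_nhds_iff.1 (h (ε / 2) (by positivity))
    refine Metric.eventually_nhds_iff.2 ⟨δ / 2, by positivity, fun g hg q hq => ?_⟩
    obtain ⟨x, r, rfl⟩ : ∃ x r, g = WithLp.toLp 2 (x, r) := ⟨g.fst, g.snd, rfl⟩
    obtain rfl : r = Metric.infDist x A := hq.1
    rw [dist_eq_norm, ← WithLp.toLp_sub, Prod.mk_sub_mk, hy0, sub_zero] at hg
    rw [← WithLp.toLp_sub, Prod.mk_sub_mk, hy0, sub_zero, WithLp.prod_inner_apply]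
    have hxy := norm_le_norm_toLp (x - y) (Metric.infDist x A)
    have hq1 : ‖q.fst‖ ≤ ‖q‖ := norm_le_norm_toLp q.fst q.snd
    have hq2 : |q.snd| ≤ ‖q‖ := abs_le_norm_toLp q.fst q.snd
    have hsnd : ⟪q.snd, Metric.infDist x A⟫ = q.snd * Metric.infDist x A := by
      simp [mul_comm]
    change |⟪q.fst, x - y⟫ + ⟪q.snd, Metric.infDist x A⟫| ≤ _
    rw [hsnd]
    by_cases hx : x ∈ A
    · rw [Metric.infDist_zero_of_mem hx] at hxy hg ⊢
      rw [mul_zero, add_zero]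
      refine (hball (y := x) ?_ _ (fst_mem_regularNormalCone hx hq)).trans ?_
      · rw [dist_eq_norm]; linarith
      · gcongr
        linarith
    · have hest : ∀ z ∈ A, ‖z - y‖ ≤ 2 * ‖x - y‖ → ∀ p ∈ regularNormalCone A z,
          |⟪p, z - y⟫| ≤ ε / 2 * (‖z - y‖ * ‖p‖) := fun z _ hz p hp =>
        hball (by rw [dist_eq_norm]; linarith) p hp
      have hp := inner_add_mul_infDist_le hA hy hx (by positivity) (abs_one) rfl hest hq
      have hn := inner_add_mul_infDist_le hA hy hx (by positivity)
        (by rw [abs_neg, abs_one] : |(-1 : ℝ)| = 1) rfl hest hq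
      have hb : 2 * (ε / 2) * (‖x - y‖ * |q.snd|) ≤
          ε * (‖WithLp.toLp 2 (x - y, Metric.infDist x A)‖ * ‖q‖) := by
        rw [mul_div_cancel₀ ε two_ne_zero]
        gcongr
      rw [abs_le]
      constructor <;> linarith
  · intro h ε hε
    have hc : Tendsto (fun x => WithLp.toLp 2 (x, Metric.infDist x A)) (𝓝 y)
        (𝓝 (WithLp.toLp 2 (y, Metric.infDist y A))) :=
      ((WithLp.prod_continuous_toLp 2 E ℝ).comp
        (continuous_id.prodMk (Metric.continuous_infDist_pt A))).tendsto y
    -- Half of `ε` suffices because `‖(p, -‖p‖)‖ ≤ 2‖p‖`.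
    filter_upwards [hc.eventually (h (ε / 2) (by positivity))] with x hx p hp
    have h1 := hx _ (toLp_neg_norm_mem_regularNormalCone hA hp)
    rw [← WithLp.toLp_sub, Prod.mk_sub_mk, hy0, Metric.infDist_zero_of_mem hp.1, sub_zero,
      WithLp.prod_inner_apply] at h1
    have h2 := norm_toLp_le (x - y) 0
    have h3 := norm_toLp_le p (-‖p‖)
    rw [abs_zero, add_zero] at h2
    rw [abs_neg, abs_norm] at h3
    simp only [inner_zero_right, add_zero] at h1
    refine h1.trans ?_
    calc _ ≤ ε / 2 * (‖x - y‖ * (‖p‖ + ‖p‖)) := by gcongr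
      _ = _ := by ring

end Distance

end SemismoothStar

theorem mainTheorem10 (s : ℕ) (A : Set (EuclideanSpace ℝ (Fin s))) (hA : IsClosed A)
    (xbar : EuclideanSpace ℝ (Fin s)) (hx : xbar ∈ A) :
    SemismoothStar.IsSemismoothStarSet A xbar ↔
      SemismoothStar.IsSemismoothStarFun
        (fun x : EuclideanSpace ℝ (Fin s) => Metric.infDist x A) xbar :=
  SemismoothStar.isSemismoothStarSet_iff_isSemismoothStarFun_infDist hA hx
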